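/- Let $k$ be a field, let $K$ be its algebraic closure, let $m, n$ be positive integers, let $g, f_1, \ldots, f_m \in k[t_1,\ldots,t_n]$, and let $h : K^m \to K$ be an arbitrary function. Let $R := \{(f_1(a),\ldots,f_m(a)) : a \in K^n\} \subseteq K^m$ be the range of the function $\mathbf{f} : K^n \to K^m$ that $(f_1,\ldots,f_m)$ induces on $K$. Let $\overline{K^m \setminus R}$ be the Zariski closure of $K^m \setminus R$ in $K^m$. The dimension of an algebraic set $A \subseteq K^m$ is defined by $\dim(\emptyset) := -1$ and, for $A \neq \emptyset$, as the largest $d \in \{0,\ldots,m\}$ for which there are $i_1 < \cdots < i_d$ in $\{1,\ldots,m\}$ such that no nonzero polynomial in $K[x_{i_1},\ldots,x_{i_d}]$ vanishes on all of $A$. Assume that $$\dim\bigl(\overline{K^m \setminus R}\bigr) \le m-2$$ and that $h(\mathbf{f}(a)) = g(a)$ for all $a \in K^n$. Then: 1. If $k$ has characteristic $0$, there is $p \in k[x_1,\ldots,x_m]$ such that $h(b) = p(b)$ for all $b \in R$. 2. If $k$ has characteristic $\chi > 0$, there are $p \in k[x_1,\ldots,x_m]$ and an integer $\nu \ge 0$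 such that $h(b) = s^{(\chi^\nu)}(p(b))$ for all $b \in R$, where for $y \in K$, $s^{(\chi^\nu)}(y)$ denotes the unique element of $K$ with $\bigl(s^{(\chi^\nu)}(y)\bigr)^{\chi^\nu} = y$. -/

import Mathlib

namespace PolyComp

open MvPolynomial

/-- The Zariski closure `V(I(A))` of a subset `A` of the affine space `K^m`. -/
def zariskiClosure {K : Type*} [Field K] {m : ℕ} (A : Set (Fin m → K)) : Set (Fin m → K) :=
  zeroLocus K (vanishingIdeal K A)

open Classical in
/-- The dimension of an algebraic set `A` in `K^m`: it is `-1` if `A` is empty, and otherwise the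
largest cardinality of a set `S` of coordinates with `I(A) ∩ K[x_i : i ∈ S] = {0}`
(for nonempty `A` the empty set of coordinates has this property). -/
noncomputable def algSetDim {K : Type*} [Field K] {m : ℕ} (A : Set (Fin m → K)) : ℤ :=
  if A = ∅ then -1
  else
    (((Finset.univ : Finset (Finset (Fin m))).filter
      (fun S : Finset (Fin m) => ∀ p ∈ vanishingIdeal K A, p ∈ supported K (S : Set (Fin m)) → p = 0)).sup
        Finset.card : ℕ)

/-- The map `K^n → K^m` induced by a tuple `f = (f_1, …, f_m)` of polynomials over `k`. -/
noncomputable def polyMap {k : Type*} [Field k] (K : Type*) [Field K] [Algebra k K] {m n : ℕ}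
    (f : Fin m → MvPolynomial (Fin n) k) (a : Fin n → K) : Fin m → K :=
  fun i => aeval a (f i)

/-- A `χ^ν`-th root of `y`. If `K` has characteristic `χ`, it is the only one
(see `charRoot_unique`). -/
noncomputable def charRoot {K : Type*} [Field K] [IsAlgClosed K] (χ : ℕ) (hχ : 0 < χ) (ν : ℕ)
    (y : K) : K :=
  Classical.choose (IsAlgClosed.exists_pow_nat_eq y (pow_pos hχ ν))

theorem charRoot_pow {K : Type*} [Field K] [IsAlgClosed K] (χ : ℕ) (hχ : 0 < χ) (ν : ℕ)
    (y : K) : charRoot χ hχ ν y ^ χ ^ ν = y :=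
  Classical.choose_spec (IsAlgClosed.exists_pow_nat_eq y (pow_pos hχ ν))

theorem charRoot_unique {K : Type*} [Field K] [IsAlgClosed K] (χ : ℕ) (hχ : 0 < χ) [CharP K χ]
    (ν : ℕ) (y z : K) (hz : z ^ χ ^ ν = y) : z = charRoot χ hχ ν y := by
  have : Fact χ.Prime := ⟨(CharP.char_is_prime_or_zero K χ).resolve_right hχ.ne'⟩
  apply iterateFrobenius_inj K χ ν
  simp only [iterateFrobenius_def]
  rw [hz, charRoot_pow]

end PolyComp

namespace PolyComp

open MvPolynomial TensorProduct

/-! Since g is constant on the fibres of f, the Nullstellensatz on pairs of points makes g ⊗ 1 - 1 ⊗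
g nilpotent over L = K(f), so g is purely inseparable over L and s(f) g^(q^ν) = r(f) with r, s
coprime (`exists_mul_pow_eq_of_constant_on_fibres`). A prime factor b of s would force r = 0 on V(b)
∩ R, while V(b) \ R is too small to matter by the codimension hypothesis; so b ∣ r, a contradiction,
and s is constant (`exists_aeval_eq_pow`). A k-linear retraction K → k then brings the coefficients
down to k. -/

/-- If `x ⊗ 1 - 1 ⊗ x` is nilpotent in `F ⊗[L] F`, then `x` is purely inseparable over `L`. -/
theorem mem_perfectClosure_of_isNilpotent {L F : Type*} [Field L] [Field F] [Algebra L F] (x : F)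
    (hx : IsNilpotent (x ⊗ₜ[L] (1 : F) - (1 : F) ⊗ₜ[L] x)) : x ∈ perfectClosure L F := by
  classical
  let Ω := AlgebraicClosure F
  let A := Algebra.adjoin L {x}
  let X : A := ⟨x, Algebra.self_mem_adjoin_singleton L x⟩
  -- By flatness F ⊗ A embeds in F ⊗ F, so nilpotency descends.
  have hX : IsNilpotent (x ⊗ₜ[L] (1 : A) - (1 : F) ⊗ₜ[L] X) := by
    have hinj : Function.Injective (Algebra.TensorProduct.map (AlgHom.id L F) A.val) :=
      Module.Flat.lTensor_preserves_injective_linearMap (M := F) A.val.toLinearMap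
        Subtype.val_injective
    rw [← IsNilpotent.map_iff hinj]
    simpa [X] using hx
  -- A root y gives τ : A → Ω with x ↦ y; pairing it with F ⊆ Ω sends the nilpotent to x - y in a
  -- field, so y = x.
  have key (y : Ω) (hy : Polynomial.aeval y (minpoly L x) = 0) : y = algebraMap F Ω x := by
    let τ : A →ₐ[L] Ω := Algebra.adjoin.liftSingleton L x y hy
    have hτ : τ X = y := by
      have hroot : AlgEquiv.adjoinSingletonEquivAdjoinRootMinpoly L x X =
          AdjoinRoot.root (minpoly L x) := by
        rw [← AlgEquiv.eq_symm_apply,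
          AlgEquiv.coe_adjoinSingletonEquivAdjoinRootMinpoly_symm]
        exact Subtype.ext (by simp [X, AdjoinRoot.Minpoly.toAdjoin])
      change AdjoinRoot.liftAlgHom (minpoly L x) (Algebra.ofId L Ω) y hy
        (AlgEquiv.adjoinSingletonEquivAdjoinRootMinpoly L x X) = y
      rw [hroot]
      exact AdjoinRoot.lift_root hy
    let φ : F ⊗[L] A →ₐ[L] Ω :=
      Algebra.TensorProduct.productMap (IsScalarTower.toAlgHom L F Ω) τ
    have h := (hX.map φ).eq_zero
    simp only [φ, map_sub, Algebra.TensorProduct.productMap_apply_tmul, map_one, mul_one, one_mul,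
      hτ] at h
    exact (sub_eq_zero.mp h).symm
  have hroot : Polynomial.aeval (algebraMap F Ω x) (minpoly L x) = 0 := by
    rw [Polynomial.aeval_algebraMap_apply, minpoly.aeval, map_zero]
  -- For transcendental x, `minpoly` is 0 and every y is a root, even x + 1.
  have h0 : minpoly L x ≠ 0 := by
    intro h0
    have := key (algebraMap F Ω x + 1) (by simp [h0])
    simp at this
  rw [mem_perfectClosure_iff_natSepDegree_eq_one,
    Polynomial.natSepDegree_eq_of_isAlgClosed Ω, Finset.card_eq_one]
  refine ⟨algebraMap F Ω x, ?_⟩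
  ext y
  simp only [Multiset.mem_toFinset, Polynomial.mem_aroots, Finset.mem_singleton]
  exact ⟨fun h => key y h.2, fun h => ⟨h0, h ▸ hroot⟩⟩

variable {K : Type*} [Field K] {m n : ℕ}

/-- If `g` is constant on the fibres of `f`, then `g ⊗ 1 - 1 ⊗ g` is nilpotent in `F ⊗[L] F` for every
tower `K ⊆ L ⊆ F` such that `L` contains the values of the `f i` at a point `t` of `F^n`. -/
theorem isNilpotent_tmul_sub_of_constant_on_fibres [IsAlgClosed K]
    {f : Fin m → MvPolynomial (Fin n) K} {g : MvPolynomial (Fin n) K}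
    (hfg : ∀ a b : Fin n → K, (∀ i, aeval a (f i) = aeval b (f i)) → aeval a g = aeval b g)
    {L F : Type*} [Field L] [Field F] [Algebra K L] [Algebra L F] [Algebra K F]
    [IsScalarTower K L F] (t : Fin n → F) (hL : ∀ i, aeval t (f i) ∈ (algebraMap L F).range) :
    IsNilpotent (aeval t g ⊗ₜ[L] (1 : F) - (1 : F) ⊗ₜ[L] aeval t g) := by
  let δ (q : MvPolynomial (Fin n) K) : MvPolynomial (Fin n ⊕ Fin n) K :=
    rename Sum.inl q - rename Sum.inr q
  -- The common zeros of the δ (f i) are the pairs of points in one fibre.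
  have hδ : δ g ∈ (Ideal.span (Set.range fun i => δ (f i))).radical := by
    rw [← vanishingIdeal_zeroLocus_eq_radical (K := K)]
    intro x hx
    simp only [δ, map_sub, aeval_rename, sub_eq_zero]
    apply hfg
    intro i
    have := hx _ (Ideal.subset_span ⟨i, rfl⟩)
    simpa only [δ, map_sub, aeval_rename, sub_eq_zero] using this
  let φ : MvPolynomial (Fin n ⊕ Fin n) K →ₐ[K] F ⊗[L] F :=
    aeval (Sum.elim (fun i => t i ⊗ₜ 1) (fun i => 1 ⊗ₜ t i))
  have hφ (q : MvPolynomial (Fin n) K) :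
      φ (δ q) = aeval t q ⊗ₜ[L] (1 : F) - (1 : F) ⊗ₜ[L] aeval t q := by
    simp only [φ, δ, map_sub, aeval_rename]
    congr 1
    · exact (DFunLike.congr_fun (comp_aeval t
        ((Algebra.TensorProduct.includeLeft : F →ₐ[L] F ⊗[L] F).restrictScalars K)) q).symm
    · exact (DFunLike.congr_fun (comp_aeval t
        ((Algebra.TensorProduct.includeRight : F →ₐ[L] F ⊗[L] F).restrictScalars K)) q).symm
  rw [← hφ]
  obtain ⟨N, hN⟩ := hδ
  refine ⟨N, ?_⟩
  rw [← map_pow, ← RingHom.mem_ker]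
  refine Ideal.span_le.mpr ?_ hN
  rintro _ ⟨i, rfl⟩
  obtain ⟨c, hc⟩ := hL i
  simp only [SetLike.mem_coe, RingHom.mem_ker]
  rw [hφ, ← hc, Algebra.algebraMap_eq_smul_one, TensorProduct.smul_tmul, sub_self]

/-- If `g` is constant on the fibres of `f`, then some `q ^ ν`-th power of `g` is a rational function
of `f`, where `q` is the characteristic exponent. -/
theorem exists_mul_pow_eq_of_constant_on_fibres [IsAlgClosed K] (q : ℕ) [ExpChar K q]
    {f : Fin m → MvPolynomial (Fin n) K} {g : MvPolynomial (Fin n) K}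
    (hfg : ∀ a b : Fin n → K, (∀ i, aeval a (f i) = aeval b (f i)) → aeval a g = aeval b g) :
    ∃ (ν : ℕ) (r s : MvPolynomial (Fin m) K), aeval f s ≠ 0 ∧
      aeval f s * g ^ q ^ ν = aeval f r := by
  let R := MvPolynomial (Fin n) K
  let F := FractionRing R
  let ι : R →ₐ[K] F := IsScalarTower.toAlgHom K R F
  have hι : Function.Injective ι := IsFractionRing.injective R F
  let L := IntermediateField.adjoin K (Set.range fun i => ι (f i))
  let t : Fin n → F := fun i => ι (X i)
  have ht (p : R) : aeval t p = ι p := by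
    rw [← comp_aeval_apply, aeval_X_left_apply]
  have hnil := isNilpotent_tmul_sub_of_constant_on_fibres hfg (L := L) t fun i => by
    rw [ht]
    exact ⟨⟨_, IntermediateField.subset_adjoin K _ ⟨i, rfl⟩⟩, rfl⟩
  have : ExpChar L q := expChar_of_injective_algebraMap (algebraMap K L).injective q
  obtain ⟨ν, ⟨⟨y, hyL⟩, hy⟩⟩ := (mem_perfectClosure_iff_pow_mem q).mp
    (mem_perfectClosure_of_isNilpotent _ hnil)
  obtain ⟨r, s, hrs⟩ := (IntermediateField.mem_adjoin_range_iff K _ _).mp hyL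
  have hcomp (p : MvPolynomial (Fin m) K) :
      aeval (fun i => ι (f i)) p = ι (aeval f p) := (comp_aeval_apply ..).symm
  rw [hcomp, hcomp] at hrs
  replace hy : y = ι g ^ q ^ ν := by rw [← ht]; exact hy
  -- If s(f) = 0, division by zero gives y = 0, hence g = 0.
  by_cases hs : aeval f s = 0
  · refine ⟨ν, 0, 1, by simp, ?_⟩
    rw [hs, map_zero, div_zero] at hrs
    rw [hrs, ← map_pow] at hy
    rw [map_one, one_mul, map_zero]
    exact hι (by rw [← hy, map_zero])
  · refine ⟨ν, r, s, hs, hι ?_⟩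
    have hs' : ι (aeval f s) ≠ 0 := by rwa [ne_eq, map_eq_zero_iff _ hι]
    rw [map_mul, map_pow, ← hy, hrs, mul_div_cancel₀ _ hs']

/-- If the Zariski closure of `A` has codimension at least two, then for every coordinate `i` there is
a nonzero polynomial without the variable `i` that vanishes on `A`. -/
theorem exists_supported_vanishing_compl {A : Set (Fin m → K)}
    (hdim : algSetDim (zariskiClosure A) ≤ (m : ℤ) - 2) (i : Fin m) :
    ∃ c : MvPolynomial (Fin m) K, c ≠ 0 ∧ i ∉ c.vars ∧ ∀ x ∈ A, aeval x c = 0 := by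
  classical
  have hsub : A ⊆ zariskiClosure A := zeroLocus_vanishingIdeal_le A
  by_contra! H
  have hne : zariskiClosure A ≠ ∅ := by
    intro h
    obtain ⟨x, hx, -⟩ := H 1 one_ne_zero (by simp)
    exact (h ▸ hsub hx : x ∈ (∅ : Set _))
  rw [algSetDim, if_neg hne] at hdim
  -- Without such a c, these m - 1 coordinates would witness dimension at least m - 1.
  have hmem : (Finset.univ.erase i) ∈ (Finset.univ : Finset (Finset (Fin m))).filter
      (fun S : Finset (Fin m) => ∀ p ∈ vanishingIdeal K (zariskiClosure A),
        p ∈ supported K (S : Set (Fin m)) → p = 0) := by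
    refine Finset.mem_filter.mpr ⟨Finset.mem_univ _, fun p hp hps => ?_⟩
    by_contra hp0
    obtain ⟨x, hx, hxp⟩ := H p hp0 fun hi => by
      simpa using mem_supported.mp hps hi
    exact hxp (hp x (hsub hx))
  have hle := Finset.le_sup (f := Finset.card) hmem
  rw [Finset.card_erase_of_mem (Finset.mem_univ i), Finset.card_univ, Fintype.card_fin] at hle
  have := i.pos
  have h2 : ((m - 1 : ℕ) : ℤ) ≤ (m : ℤ) - 2 := le_trans (by exact_mod_cast hle) hdim
  omega

/-- If `g` is constant on the fibres of `f` and the complement of the range of `f` has codimension at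
least two, then some `q ^ ν`-th power of `g` is a polynomial in `f`. -/
theorem exists_aeval_eq_pow [IsAlgClosed K] (q : ℕ) [ExpChar K q]
    {f : Fin m → MvPolynomial (Fin n) K} {g : MvPolynomial (Fin n) K}
    (hdim : algSetDim (zariskiClosure (Set.range (polyMap K f))ᶜ) ≤ (m : ℤ) - 2)
    (hfg : ∀ a b : Fin n → K, polyMap K f a = polyMap K f b → aeval a g = aeval b g) :
    ∃ (ν : ℕ) (p : MvPolynomial (Fin m) K), aeval f p = g ^ q ^ ν := by
  obtain ⟨ν, r₀, s₀, hs₀, heq₀⟩ := exists_mul_pow_eq_of_constant_on_fibres q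
    fun a b h => hfg a b (funext h)
  obtain ⟨r, s, d, hrel, rfl, rfl⟩ := UniqueFactorizationMonoid.exists_reduced_factors' r₀ s₀
    (by rintro rfl; simp at hs₀)
  rw [map_mul] at hs₀ heq₀
  rw [map_mul, mul_assoc] at heq₀
  have heq := mul_left_cancel₀ (left_ne_zero_of_mul hs₀) heq₀
  have hs : aeval f s ≠ 0 := right_ne_zero_of_mul hs₀
  suffices hu : IsUnit s by
    obtain ⟨u, rfl⟩ := hu
    refine ⟨ν, ↑u⁻¹ * r, ?_⟩
    rw [map_mul, ← heq, ← mul_assoc, ← map_mul, Units.inv_mul, map_one, one_mul]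
  by_contra hu
  obtain ⟨b, hb, hbs⟩ := WfDvdMonoid.exists_irreducible_factor hu (by rintro rfl; simp at hs)
  obtain ⟨i, hi⟩ : b.vars.Nonempty := by
    rw [Finset.nonempty_iff_ne_empty]
    intro h
    have hbC := vars_eq_empty_iff_eq_C.mp h
    refine hb.not_isUnit (hbC ▸ IsUnit.map C (IsUnit.mk0 (coeff 0 b) fun h0 => ?_))
    exact hb.ne_zero (by rw [hbC, h0, C_0])
  obtain ⟨c, hc0, hci, hc⟩ := exists_supported_vanishing_compl hdim i
  have hbp : Prime b := hb.prime
  -- On V(b), r vanishes at points of R and c at all others. As c is free of the variable i, which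
  -- occurs in b, only b ∣ r can remain.
  have hdvd : b ∣ r * c := by
    have : (Ideal.span {b}).IsPrime := (Ideal.span_singleton_prime hbp.ne_zero).mpr hbp
    rw [← Ideal.mem_span_singleton, ← IsPrime.vanishingIdeal_zeroLocus (K := K) (Ideal.span {b})]
    intro y hy
    have hby : aeval y b = 0 := hy b (Ideal.mem_span_singleton_self b)
    rw [map_mul]
    by_cases hyR : y ∈ Set.range (polyMap K f)
    · obtain ⟨a, rfl⟩ := hyR
      have hcomp (p : MvPolynomial (Fin m) K) :
          aeval (polyMap K f a) p = aeval a (aeval f p) := (comp_aeval_apply ..).symm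
      obtain ⟨e, rfl⟩ := hbs
      have h := congrArg (aeval a) heq
      rw [map_mul, ← hcomp, ← hcomp, map_mul, hby, zero_mul, zero_mul] at h
      rw [← h, zero_mul]
    · rw [hc y hyR, mul_zero]
  rcases hbp.dvd_or_dvd hdvd with h | h
  · exact hb.not_isUnit (hrel h hbs)
  · obtain ⟨e, rfl⟩ := h
    rw [mem_vars_iff_degreeOf_ne_zero] at hi hci
    rw [degreeOf_mul_eq (left_ne_zero_of_mul hc0) (right_ne_zero_of_mul hc0)] at hci
    omega

/-- A polynomial over `k` that is a polynomial in `f` over `K` is a polynomial in `f` over `k`. -/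
theorem exists_aeval_eq_of_exists_aeval_map_eq {k : Type*} [Field k] [Algebra k K]
    {f : Fin m → MvPolynomial (Fin n) k} {g : MvPolynomial (Fin n) k}
    (p : MvPolynomial (Fin m) K)
    (hp : aeval (fun i => map (algebraMap k K) (f i)) p = map (algebraMap k K) g) :
    ∃ p : MvPolynomial (Fin m) k, aeval f p = g := by
  obtain ⟨ρ, hρ⟩ := (Algebra.linearMap k K).exists_leftInverse_of_injective
    (LinearMap.ker_eq_bot.mpr (algebraMap k K).injective)
  have hρ' (c : K) (x : k) : ρ (c * algebraMap k K x) = ρ c * x := by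
    rw [mul_comm, ← Algebra.smul_def, map_smul, smul_eq_mul, mul_comm]
  have hρ1 (x : k) : ρ (algebraMap k K x) = x := LinearMap.congr_fun hρ x
  -- Applying ρ to coefficients is k[t]-linear, so T maps p(f) to ρ(p)(f) and fixes g.
  let T : MvPolynomial (Fin n) K →+ MvPolynomial (Fin n) k :=
    AddMonoidHom.mk' (AddMonoidAlgebra.map ρ.toAddMonoidHom) fun u v => by
      ext d
      simp only [coeff_add, coeff_addMonoidAlgebraMap, map_add]
  have hT (u : MvPolynomial (Fin n) K) (d) : coeff d (T u) = ρ (coeff d u) :=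
    coeff_addMonoidAlgebraMap ..
  have hTmap (c : K) (u : MvPolynomial (Fin n) k) :
      T (C c * map (algebraMap k K) u) = C (ρ c) * u := by
    ext d
    rw [hT, coeff_C_mul, coeff_C_mul, coeff_map, hρ']
  have hTg : T (map (algebraMap k K) g) = g := by
    ext d
    rw [hT, coeff_map, hρ1]
  refine ⟨∑ d ∈ p.support, monomial d (ρ (coeff d p)), ?_⟩
  rw [← hTg, ← hp, map_sum]
  conv_rhs => rw [p.as_sum, map_sum, map_sum]
  refine Finset.sum_congr rfl fun d _ => ?_
  rw [aeval_monomial, aeval_monomial, algebraMap_eq, algebraMap_eq, ← hTmap]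
  simp [Finsupp.prod, map_prod, map_pow]

end PolyComp

theorem mainTheorem6
    {k : Type*} [Field k]
    {K : Type*} [Field K] [Algebra k K] [IsAlgClosed K] [Algebra.IsAlgebraic k K]
    (m n : ℕ)
    (f : Fin m → MvPolynomial (Fin n) k) (g : MvPolynomial (Fin n) k)
    (h : (Fin m → K) → K)
    (hdim : PolyComp.algSetDim (PolyComp.zariskiClosure (Set.range (PolyComp.polyMap K f))ᶜ)
      ≤ (m : ℤ) - 2)
    (hcomp : ∀ a : Fin n → K, h (PolyComp.polyMap K f a) = MvPolynomial.aeval a g) :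
    (CharP k 0 → ∃ p : MvPolynomial (Fin m) k,
      ∀ b ∈ Set.range (PolyComp.polyMap K f), h b = MvPolynomial.aeval b p) ∧
    (∀ (χ : ℕ) (hχ : 0 < χ), CharP k χ → ∃ (p : MvPolynomial (Fin m) k) (ν : ℕ),
      ∀ b ∈ Set.range (PolyComp.polyMap K f),
        h b = PolyComp.charRoot χ hχ ν (MvPolynomial.aeval b p)) := by
  have key (q : ℕ) (hq : ExpChar k q) : ∃ (p : MvPolynomial (Fin m) k) (ν : ℕ),
      ∀ b ∈ Set.range (PolyComp.polyMap K f), h b ^ q ^ ν = MvPolynomial.aeval b p := by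
    have : ExpChar K q := expChar_of_injective_algebraMap (algebraMap k K).injective q
    have hmap : PolyComp.polyMap K (fun i => MvPolynomial.map (algebraMap k K) (f i)) =
        PolyComp.polyMap K f := by
      ext a i
      exact MvPolynomial.aeval_map_algebraMap K a (f i)
    obtain ⟨ν, p, hp⟩ := PolyComp.exists_aeval_eq_pow q (K := K)
      (f := fun i => MvPolynomial.map (algebraMap k K) (f i))
      (g := MvPolynomial.map (algebraMap k K) g) (by rwa [hmap]) (by
        intro a b hab
        rw [hmap] at hab
        rw [MvPolynomial.aeval_map_algebraMap, MvPolynomial.aeval_map_algebraMap,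
          ← hcomp, ← hcomp, hab])
    rw [← map_pow] at hp
    obtain ⟨p', hp'⟩ := PolyComp.exists_aeval_eq_of_exists_aeval_map_eq p hp
    refine ⟨p', ν, ?_⟩
    rintro _ ⟨a, rfl⟩
    rw [hcomp, ← map_pow, ← hp', MvPolynomial.comp_aeval_apply]
    rfl
  constructor
  · intro hk
    have : CharZero k := CharP.charP_to_charZero k
    obtain ⟨p, ν, hp⟩ := key 1 inferInstance
    exact ⟨p, fun b hb => by simpa using hp b hb⟩
  · intro χ hχ hk
    have : Fact χ.Prime := ⟨(CharP.char_is_prime_or_zero k χ).resolve_right hχ.ne'⟩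
    have : CharP K χ := charP_of_injective_algebraMap (algebraMap k K).injective χ
    obtain ⟨p, ν, hp⟩ := key χ inferInstance
    exact ⟨p, ν, fun b hb => PolyComp.charRoot_unique χ hχ ν _ _ (hp b hb)⟩
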